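/- Let $\Lambda$ be a countable set, $M\in\mathbb N$, let $\ell_2=\ell_2(\Lambda,\mathbb R^M)$ be the Hilbert space of families $u=(u_\lambda)_{\lambda\in\Lambda}$ in $\mathbb R^M$ with $\|u\|_2^2=\sum_\lambda\|u_\lambda\|_2^2<\infty$ ($\mathbb R^M$ Euclidean), let $\mathcal H$ be a real Hilbert space, $g\in\mathcal H$, and $T:\ell_2\to\mathcal H$ a bounded linear operator with $\|T\|<1$. For $\Psi:\ell_2\to[0,\infty]$ put $$K(u)=\|Tu-g\|_{\mathcal H}^2+\Psi(u),\qquad K^s(u,a)=K(u)-\|Tu-Ta\|_{\mathcal H}^2+\|u-a\|_2^2 .$$ A thresholding operator of $\Psi$ is a map $U_\Psi:\ell_2\to\ell_2$ such that, for every $x$, the point $U_\Psi(x)$ minimizes $z\mapsto\|x-z\|_2^2+\Psi(z)$ over $\ell_2$. (a) Let $\Psi$ be not identically $\infty$, let $K$ be strictly convex (on the convex set where it is finite), and let $U_\Psi$ be a thresholding operator of $\Psi$. Assume 1. $\|U_\Psi(x)-U_\Psi(y)\|_2\le\|x-y\|_2$ for all $x,y\in\ell_2$; 2. there is a monotonically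 increasing function $h:[0,\infty)\to\mathbb R$ with $\|f\|_2\le h(\Psi(f))$ for all $f\in\ell_2$ with $\Psi(f)<\infty$; 3. $\Psi(U_\Psi(x)+h)-\Psi(U_\Psi(x))+2\langle h,U_\Psi(x)-x\rangle\ge0$ for all $x,h\in\ell_2$. Then $K$ has exactly one minimizer $u^*$ on $\ell_2$. A sequence $(u^{(m)})_{m\ge0}$ in $\ell_2$ satisfies $u^{(m+1)}\in\operatorname{arg\,min}_{w\in\ell_2}K^s(w,u^{(m)})$ for all $m$ if and only if $u^{(m+1)}=U_\Psi\bigl(u^{(m)}+T^*(g-Tu^{(m)})\bigr)$ for all $m$, and every such sequence converges weakly in $\ell_2$ to $u^*$, whatever the starting point $u^{(0)}\in\ell_2$. (b) Let $v=(v_\lambda)$ and $\omega=(\omega_\lambda)$ be families of nonnegative reals, at least one of which is bounded below by a positive constant. Let $N$ be the norm $\|\cdot\|_q$ for some $1\le q\le\infty$, or any other norm on $\mathbb R^M$, and let $$\Psi(u)=\sum_{\lambda\in\Lambda}v_\lambda N(u_\lambda)+\sum_{\lambda\in\Lambda}\omega_\lambda\|u_\lambda\|_2^2\in[0,\infty].$$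 Then $\Psi$ has exactly one thresholding operator $U_\Psi$. A sequence $(u^{(m)})_{m\ge0}$ in $\ell_2$ satisfies $u^{(m+1)}\in\operatorname{arg\,min}_{w\in\ell_2}K^s(w,u^{(m)})$ for all $m$ if and only if $u^{(m+1)}=U_\Psi\bigl(u^{(m)}+T^*(g-Tu^{(m)})\bigr)$ for all $m$, and every such sequence, with any $u^{(0)}\in\ell_2$, converges weakly in $\ell_2$ to a minimizer of $K$. -/

import Mathlib

open Set Filter Topology
open scoped NNReal ENNReal InnerProductSpace

noncomputable section

/-- The Hilbert space of square-summable families of vectors in `ℝ^M`, indexed by `Λ`. -/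
abbrev VecSeq (Λ : Type*) (M : ℕ) : Type _ :=
  lp (fun _ : Λ => EuclideanSpace ℝ (Fin M)) 2

section Functionals

variable {E H : Type*} [NormedAddCommGroup E] [InnerProductSpace ℝ E]
  [NormedAddCommGroup H] [InnerProductSpace ℝ H]

/-- `K(u) = ‖T u - g‖² + Ψ(u)`, with values in `[0, ∞]`. -/
def costFunctional (T : E →L[ℝ] H) (g : H) (Ψ : E → ℝ≥0∞) (u : E) : ℝ≥0∞ :=
  ENNReal.ofReal (‖T u - g‖ ^ 2) + Ψ u

/-- `Kˢ(u, a) = K(u) - ‖T u - T a‖² + ‖u - a‖²`, with values in the extended reals. -/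
def surrogate (T : E →L[ℝ] H) (g : H) (Ψ : E → ℝ≥0∞) (u a : E) : EReal :=
  (costFunctional T g Ψ u : EReal) - ((‖T u - T a‖ ^ 2 : ℝ) : EReal)
    + ((‖u - a‖ ^ 2 : ℝ) : EReal)

/-- Strict convexity of an extended-valued functional: its effective domain is convex, and it is
strictly convex there. -/
def StrictlyConvex (F : E → ℝ≥0∞) : Prop :=
  StrictConvexOn ℝ {u | F u ≠ ∞} (fun u => (F u).toReal)

/-- `U` maps every `x` to a minimizer of `z ↦ ‖x - z‖² + Ψ(z)`. -/
def IsThresholdingOperator (Ψ : E → ℝ≥0∞) (U : E → E) : Prop :=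
  ∀ x, IsMinOn (fun z => ENNReal.ofReal (‖x - z‖ ^ 2) + Ψ z) univ (U x)

/-- Every term is a minimizer of the surrogate functional at the preceding term. -/
def IsSurrogateIteration (T : E →L[ℝ] H) (g : H) (Ψ : E → ℝ≥0∞) (u : ℕ → E) : Prop :=
  ∀ m, IsMinOn (fun w => surrogate T g Ψ w (u m)) univ (u (m + 1))

/-- `u⁽ᵐ⁺¹⁾ = U(u⁽ᵐ⁾ + T*(g - T u⁽ᵐ⁾))`. -/
def IsThresholdedLandweber [CompleteSpace E] [CompleteSpace H]
    (T : E →L[ℝ] H) (g : H) (U : E → E) (u : ℕ → E) : Prop :=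
  ∀ m, u (m + 1) = U (u m + ContinuousLinearMap.adjoint T (g - T (u m)))

/-- Weak convergence of a sequence. -/
def WeaklyConverges (u : ℕ → E) (x : E) : Prop :=
  Tendsto (fun m => toWeakSpace ℝ E (u m)) atTop (𝓝 (toWeakSpace ℝ E x))

end Functionals

/-- The `ℓ_q` norm of a vector of `ℝ^M`. -/
def lqNorm {M : ℕ} (q : ℝ≥0∞) (x : EuclideanSpace ℝ (Fin M)) : ℝ :=
  ‖WithLp.toLp q (WithLp.ofLp x)‖

/-- `N` is a norm on `ℝ^M`. -/
def IsNormFunction {M : ℕ} (N : EuclideanSpace ℝ (Fin M) → ℝ) : Prop :=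
  (∀ x y, N (x + y) ≤ N x + N y) ∧ (∀ (c : ℝ) (x), N (c • x) = |c| * N x) ∧
    ∀ x, N x = 0 → x = 0

/-- `Ψ(u) = ∑ v_λ N(u_λ) + ∑ ω_λ ‖u_λ‖₂²`, with values in `[0, ∞]`. -/
def jointSparsity {Λ : Type*} {M : ℕ} (N : EuclideanSpace ℝ (Fin M) → ℝ) (v ω : Λ → ℝ)
    (u : VecSeq Λ M) : ℝ≥0∞ :=
  (∑' l, ENNReal.ofReal (v l * N (u l))) + ∑' l, ENNReal.ofReal (ω l * ‖u l‖ ^ 2)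

end

/-! In `surrogate` the terms quadratic in `T w` cancel, so up to a constant depending on `a` it
equals `‖landweberStep T g a - w‖² + Ψ w` (`norm_sq_landweberStep_sub`). Minimizing it is
thresholding the gradient step. Everything else rests on `IsProximal`, the subgradient inequality.
It makes `U` the unique, nonexpansive thresholding operator, makes fixed points of `S = U ∘
landweberStep T g` minimizers of `K`, and makes `K` drop by at least `(1 - ‖T‖²)‖u (m + 1) - u m‖²`
per step from a point where `Ψ` is finite. So steps tend to `0` and, by coercivity, orbits are
bounded. Opial's argument (`exists_weaklyConverges_of_nonexpansive`) then gives a weak limit fixed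
by `S`. In (a) `IsProximal` is condition 3; in (b) it follows from convexity, and lower
semicontinuity provides `U`. -/

/-! ### Weak convergence of orbits of nonexpansive maps. -/

section WeakConvergence

variable {E : Type*} [NormedAddCommGroup E] [InnerProductSpace ℝ E]

/-- Weak limits of approximate fixed points of a nonexpansive map are fixed points. -/
theorem eq_of_weak_limit_of_nonexpansive {S : E → E} (hS : ∀ x y, ‖S x - S y‖ ≤ ‖x - y‖)
    {u : ℕ → E} {R : ℝ} (hb : ∀ m, ‖u m‖ ≤ R) {F : Filter ℕ} [F.NeBot] {p : E}
    (hp : ∀ y, Tendsto (fun m => ⟪y, u m⟫_ℝ) F (𝓝 ⟪y, p⟫_ℝ))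
    (hreg : Tendsto (fun m => ‖S (u m) - u m‖) F (𝓝 0)) : S p = p := by
  have hlim : Tendsto (fun m => ‖S (u m) - u m‖ * (‖S (u m) - u m‖ + 2 * (R + ‖p‖))
      + 2 * (⟪p - S p, p⟫_ℝ - ⟪p - S p, u m⟫_ℝ)) F (𝓝 0) := by
    have := (hreg.mul (hreg.add_const (2 * (R + ‖p‖)))).add
      (((hp (p - S p)).const_sub ⟪p - S p, p⟫_ℝ).const_mul 2)
    simpa using this
  have hle : ∀ m, ‖p - S p‖ ^ 2 ≤ ‖S (u m) - u m‖ * (‖S (u m) - u m‖ + 2 * (R + ‖p‖))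
      + 2 * (⟪p - S p, p⟫_ℝ - ⟪p - S p, u m⟫_ℝ) := by
    intro m
    have h1 : ‖u m - S p‖ ≤ ‖S (u m) - u m‖ + ‖u m - p‖ := by
      have := norm_sub_le_norm_sub_add_norm_sub (u m) (S (u m)) (S p)
      rw [norm_sub_rev (u m) (S (u m))] at this
      linarith [hS (u m) p]
    have h2 : ‖u m - p‖ ≤ R + ‖p‖ := (norm_sub_le _ _).trans (by linarith [hb m])
    -- Opial's identity: under weak convergence to `p`, the point `S p` is asymptotically farther
    -- from `u m` than `p`, by `‖p - S p‖²` in squared distance; nonexpansiveness forbids any gap.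
    have h3 : ‖u m - S p‖ ^ 2 = ‖u m - p‖ ^ 2
        + 2 * (⟪p - S p, u m⟫_ℝ - ⟪p - S p, p⟫_ℝ) + ‖p - S p‖ ^ 2 := by
      rw [show u m - S p = (u m - p) + (p - S p) by abel, norm_add_sq_real,
        real_inner_comm, inner_sub_right]
    have h4 : ‖u m - S p‖ ^ 2 ≤ (‖S (u m) - u m‖ + ‖u m - p‖) ^ 2 :=
      pow_le_pow_left₀ (norm_nonneg _) h1 2
    nlinarith [mul_le_mul_of_nonneg_left h2 (norm_nonneg (S (u m) - u m))]
  have h0 : ‖p - S p‖ ^ 2 ≤ 0 := ge_of_tendsto' hlim hle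
  have : ‖p - S p‖ = 0 := by nlinarith [norm_nonneg (p - S p)]
  exact (sub_eq_zero.1 (norm_eq_zero.1 this)).symm

variable [CompleteSpace E]

theorem weaklyConverges_iff_inner {u : ℕ → E} {x : E} :
    WeaklyConverges u x ↔ ∀ y, Tendsto (fun m => ⟪y, u m⟫_ℝ) atTop (𝓝 ⟪y, x⟫_ℝ) := by
  have key : WeaklyConverges u x ↔
      ∀ f : StrongDual ℝ E, Tendsto (fun m => f (u m)) atTop (𝓝 (f x)) :=
    WeakBilin.tendsto_iff_forall_eval_tendsto (topDualPairing ℝ E).flip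
      (fun a b h => ext_inner_left ℝ fun v => by
        simpa using LinearMap.congr_fun h (InnerProductSpace.toDual ℝ E v))
  rw [key]
  constructor
  · intro h y
    exact h (InnerProductSpace.toDual ℝ E y)
  · intro h f
    have := h ((InnerProductSpace.toDual ℝ E).symm f)
    simpa using this

/-- Bounded sequences converge weakly along every ultrafilter. -/
theorem exists_weak_limit_ultrafilter {u : ℕ → E} {R : ℝ} (hb : ∀ m, ‖u m‖ ≤ R)
    (F : Ultrafilter ℕ) :
    ∃ p : E, ∀ y, Tendsto (fun m => ⟪y, u m⟫_ℝ) F (𝓝 ⟪y, p⟫_ℝ) := by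
  -- Riesz carries the sequence into a ball of the dual, weak-* compact by Banach–Alaoglu;
  -- ultrafilters replace subsequences.
  let φ : ℕ → WeakDual ℝ E :=
    fun m => StrongDual.toWeakDual (InnerProductSpace.toDual ℝ E (u m))
  have hK := WeakDual.isCompact_closedBall (𝕜 := ℝ) (E := E) 0 R
  obtain ⟨ψ, -, hψ⟩ := hK.ultrafilter_le_nhds (F.map φ) (by
    rw [le_principal_iff]
    refine Filter.mem_map.2 (Filter.univ_mem' fun m => ?_)
    have : ‖InnerProductSpace.toDual ℝ E (u m)‖ ≤ R :=
      (LinearIsometryEquiv.norm_map _ _).trans_le (hb m)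
    exact mem_closedBall_zero_iff.2 this)
  refine ⟨(InnerProductSpace.toDual ℝ E).symm (WeakDual.toStrongDual ψ), fun y => ?_⟩
  have h : Tendsto (fun m => φ m y) F (𝓝 (ψ y)) :=
    ((WeakDual.eval_continuous y).tendsto ψ).comp hψ
  rw [real_inner_comm, InnerProductSpace.toDual_symm_apply]
  refine h.congr fun m => ?_
  rw [real_inner_comm]
  rfl

/-- Bounded, asymptotically regular orbits of a nonexpansive map on a Hilbert space converge weakly
to a fixed point. -/
theorem exists_weaklyConverges_of_nonexpansive {S : E → E}
    (hS : ∀ x y, ‖S x - S y‖ ≤ ‖x - y‖) {u : ℕ → E} (hu : ∀ m, u (m + 1) = S (u m))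
    {R : ℝ} (hb : ∀ m, ‖u m‖ ≤ R)
    (hreg : Tendsto (fun m => ‖u (m + 1) - u m‖) atTop (𝓝 0)) :
    ∃ p, S p = p ∧ WeaklyConverges u p := by
  have hreg' : Tendsto (fun m => ‖S (u m) - u m‖) atTop (𝓝 0) := by simpa only [hu] using hreg
  have hex : ∀ F : Ultrafilter ℕ, (F : Filter ℕ) ≤ atTop →
      ∃ p, S p = p ∧ ∀ y, Tendsto (fun m => ⟪y, u m⟫_ℝ) F (𝓝 ⟪y, p⟫_ℝ) := fun F hF => by
    obtain ⟨p, hp⟩ := exists_weak_limit_ultrafilter hb F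
    exact ⟨p, eq_of_weak_limit_of_nonexpansive hS hb hp (hreg'.mono_left hF), hp⟩
  have hnorm : ∀ p, S p = p → ∃ l, Tendsto (fun m => ‖u m - p‖ ^ 2) atTop (𝓝 l) := by
    intro p hp
    refine ⟨_, tendsto_atTop_ciInf (antitone_nat_of_succ_le fun m => ?_)
      ⟨0, by rintro _ ⟨m, rfl⟩; positivity⟩⟩
    refine pow_le_pow_left₀ (norm_nonneg _) ?_ 2
    have := hS (u m) p
    rwa [hp, ← hu] at this
  obtain ⟨p, hp, hpF⟩ := hex (Ultrafilter.of atTop) (Ultrafilter.of_le _)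
  refine ⟨p, hp, weaklyConverges_iff_inner.2 fun y => ?_⟩
  rw [tendsto_iff_ultrafilter]
  intro G hG
  obtain ⟨q, hq, hqG⟩ := hex G hG
  suffices h : q = p by rw [← h]; exact hqG y
  obtain ⟨a, ha⟩ := hnorm p hp
  obtain ⟨b, hb'⟩ := hnorm q hq
  -- The difference of the squared distances to `p` and `q` is affine in `u m`, so `⟪p - q, u m⟫`
  -- converges along the whole sequence. Its limits along the two ultrafilters agree: `⟪p - q, p⟫ =
  -- ⟪p - q, q⟫`.
  have hlim : Tendsto (fun m => ⟪p - q, u m⟫_ℝ) atTop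
      (𝓝 ((b - a + (‖p‖ ^ 2 - ‖q‖ ^ 2)) / 2)) := by
    refine (((hb'.sub ha).add_const (‖p‖ ^ 2 - ‖q‖ ^ 2)).div_const 2).congr fun m => ?_
    rw [norm_sub_sq_real, norm_sub_sq_real, inner_sub_left, real_inner_comm (u m) p,
      real_inner_comm (u m) q]
    ring
  have h1 := tendsto_nhds_unique (hlim.mono_left (Ultrafilter.of_le _)) (hpF (p - q))
  have h2 := tendsto_nhds_unique (hlim.mono_left hG) (hqG (p - q))
  have h3 : ⟪p - q, p - q⟫_ℝ = 0 := by rw [inner_sub_right]; linarith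
  exact (sub_eq_zero.1 (inner_self_eq_zero.1 h3)).symm

end WeakConvergence

/-! ### Reduction of minimization in `[0, ∞]` to real inequalities. -/

section Minimizers

variable {E : Type*}

theorem isMinOn_ofReal_add_iff {Ψ : E → ℝ≥0∞} (hΨ : ∃ f, Ψ f ≠ ∞) {r : E → ℝ}
    (hr : ∀ z, 0 ≤ r z) {p : E} :
    IsMinOn (fun z => ENNReal.ofReal (r z) + Ψ z) univ p ↔
      Ψ p ≠ ∞ ∧ ∀ z, Ψ z ≠ ∞ → r p + (Ψ p).toReal ≤ r z + (Ψ z).toReal := by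
  have key : ∀ z, Ψ z ≠ ∞ → ENNReal.ofReal (r z) + Ψ z
      = ENNReal.ofReal (r z + (Ψ z).toReal) := fun z hz => by
    rw [ENNReal.ofReal_add (hr z) ENNReal.toReal_nonneg, ENNReal.ofReal_toReal hz]
  rw [isMinOn_univ_iff]
  constructor
  · intro h
    obtain ⟨f, hf⟩ := hΨ
    have hp : Ψ p ≠ ∞ := fun hp => by
      have := h f
      rw [hp, add_top, top_le_iff, key f hf] at this
      exact ENNReal.ofReal_ne_top this
    refine ⟨hp, fun z hz => ?_⟩
    have := h z
    rwa [key p hp, key z hz, ENNReal.ofReal_le_ofReal_iff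
      (add_nonneg (hr z) ENNReal.toReal_nonneg)] at this
  · rintro ⟨hp, h⟩ z
    by_cases hz : Ψ z = ∞
    · simp [hz]
    · rw [key p hp, key z hz]
      exact ENNReal.ofReal_le_ofReal (h z hz)

end Minimizers

/-! ### Proximal maps and the thresholded Landweber iteration. -/

section Iteration

variable {E H : Type*} [NormedAddCommGroup E] [InnerProductSpace ℝ E]
  [NormedAddCommGroup H] [InnerProductSpace ℝ H]

/-- `2 (x - U x)` is a subgradient of `Ψ` at `U x`, a point where `Ψ` is finite. -/
def IsProximal (Ψ : E → ℝ≥0∞) (U : E → E) : Prop :=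
  ∀ x, Ψ (U x) ≠ ∞ ∧ ∀ z, Ψ z ≠ ∞ →
    (Ψ (U x)).toReal ≤ (Ψ z).toReal + 2 * ⟪z - U x, U x - x⟫_ℝ

theorem surrogate_of_eq_top {T : E →L[ℝ] H} {g : H} {Ψ : E → ℝ≥0∞} {w : E} (a : E)
    (hw : Ψ w = ∞) : surrogate T g Ψ w a = ⊤ := by
  rw [surrogate, costFunctional, hw, add_top, EReal.coe_ennreal_top, EReal.top_sub_coe,
    EReal.top_add_coe]

theorem surrogate_of_ne_top {T : E →L[ℝ] H} {g : H} {Ψ : E → ℝ≥0∞} {w : E} (a : E)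
    (hw : Ψ w ≠ ∞) :
    surrogate T g Ψ w a = ((‖T w - g‖ ^ 2 + (Ψ w).toReal - ‖T w - T a‖ ^ 2 + ‖w - a‖ ^ 2 : ℝ)
      : EReal) := by
  have h : costFunctional T g Ψ w = ENNReal.ofReal (‖T w - g‖ ^ 2 + (Ψ w).toReal) := by
    rw [costFunctional, ENNReal.ofReal_add (by positivity) ENNReal.toReal_nonneg,
      ENNReal.ofReal_toReal hw]
  rw [surrogate, h, EReal.coe_ennreal_ofReal,
    max_eq_left (add_nonneg (by positivity) ENNReal.toReal_nonneg)]
  push_cast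
  rfl

namespace IsProximal

variable {Ψ : E → ℝ≥0∞} {U : E → E}

/-- Expand `‖x - z‖²` about `U x`. The surplus `‖z - U x‖²` is what makes the minimizer unique. -/
theorem add_norm_sq_le (hU : IsProximal Ψ U) (x : E) {z : E} (hz : Ψ z ≠ ∞) :
    ‖x - U x‖ ^ 2 + (Ψ (U x)).toReal + ‖z - U x‖ ^ 2 ≤ ‖x - z‖ ^ 2 + (Ψ z).toReal := by
  have h := (hU x).2 z hz
  have h2 : ‖x - z‖ ^ 2 = ‖z - U x‖ ^ 2 + 2 * ⟪z - U x, U x - x⟫_ℝ + ‖x - U x‖ ^ 2 := by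
    rw [norm_sub_rev x z, norm_sub_rev x (U x), ← norm_add_sq_real, sub_add_sub_cancel]
  linarith

theorem isMinOn_iff (hU : IsProximal Ψ U) {x p : E} :
    IsMinOn (fun z => ENNReal.ofReal (‖x - z‖ ^ 2) + Ψ z) univ p ↔ p = U x := by
  rw [isMinOn_ofReal_add_iff ⟨U x, (hU x).1⟩ (fun _ => by positivity)]
  constructor
  · rintro ⟨hp, h⟩
    have h1 := h _ (hU x).1
    have h2 := hU.add_norm_sq_le x hp
    have : ‖p - U x‖ = 0 := by nlinarith [norm_nonneg (p - U x)]
    exact sub_eq_zero.1 (norm_eq_zero.1 this)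
  · rintro rfl
    exact ⟨(hU x).1, fun z hz => by nlinarith [hU.add_norm_sq_le x hz, sq_nonneg ‖z - U x‖]⟩

/-- Monotonicity of the subdifferential: adding the inequalities at `x` and `y` cancels `Ψ`, leaving
`‖U x - U y‖² ≤ ⟪U x - U y, x - y⟫`. -/
theorem nonexpansive (hU : IsProximal Ψ U) (x y : E) : ‖U x - U y‖ ≤ ‖x - y‖ := by
  have h1 := (hU x).2 _ (hU y).1
  have h2 := (hU y).2 _ (hU x).1
  have h3 : ⟪U y - U x, U x - x⟫_ℝ + ⟪U x - U y, U y - y⟫_ℝ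
      = ⟪U x - U y, x - y⟫_ℝ - ‖U x - U y‖ ^ 2 := by
    rw [← real_inner_self_eq_norm_sq, ← neg_sub (U x) (U y), inner_neg_left, ← inner_sub_right,
      neg_add_eq_sub, ← inner_sub_right]
    congr 1
    abel
  have h4 := real_inner_le_norm (U x - U y) (x - y)
  by_contra! h5
  nlinarith [norm_nonneg (x - y), norm_nonneg (U x - U y)]

end IsProximal

variable [CompleteSpace E] [CompleteSpace H]

/-- The gradient step `a + T*(g - T a)`. -/
noncomputable def landweberStep (T : E →L[ℝ] H) (g : H) (a : E) : E :=
  a + ContinuousLinearMap.adjoint T (g - T a)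

theorem norm_sq_landweberStep_sub (T : E →L[ℝ] H) (g : H) (w a : E) :
    ‖T w - g‖ ^ 2 - ‖T w - T a‖ ^ 2 + ‖w - a‖ ^ 2 = ‖landweberStep T g a - w‖ ^ 2
      + (‖T a - g‖ ^ 2 - ‖ContinuousLinearMap.adjoint T (g - T a)‖ ^ 2) := by
  have h1 : ‖T w - g‖ ^ 2 = ‖T w - T a‖ ^ 2 + 2 * ⟪T w - T a, T a - g⟫_ℝ + ‖T a - g‖ ^ 2 := by
    rw [← norm_add_sq_real, sub_add_sub_cancel]
  have h2 : ‖landweberStep T g a - w‖ ^ 2 = ‖w - a‖ ^ 2 + 2 * ⟪T w - T a, T a - g⟫_ℝ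
      + ‖ContinuousLinearMap.adjoint T (g - T a)‖ ^ 2 := by
    rw [landweberStep, show a + ContinuousLinearMap.adjoint T (g - T a) - w
      = (a - w) + ContinuousLinearMap.adjoint T (g - T a) by abel, norm_add_sq_real,
      ContinuousLinearMap.adjoint_inner_right, map_sub, norm_sub_rev a w,
      ← neg_sub (T w), ← neg_sub (T a) g, inner_neg_neg]
  linarith

theorem isMinOn_surrogate_iff {T : E →L[ℝ] H} {g : H} {Ψ : E → ℝ≥0∞} (hΨ : ∃ f, Ψ f ≠ ∞)
    {a p : E} :
    IsMinOn (fun w => surrogate T g Ψ w a) univ p ↔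
      IsMinOn (fun z => ENNReal.ofReal (‖landweberStep T g a - z‖ ^ 2) + Ψ z) univ p := by
  rw [isMinOn_ofReal_add_iff hΨ (fun _ => by positivity), isMinOn_univ_iff]
  have key := norm_sq_landweberStep_sub T g
  constructor
  · intro h
    obtain ⟨f, hf⟩ := hΨ
    have hp : Ψ p ≠ ∞ := fun hp => by
      have := h f
      rw [surrogate_of_eq_top a hp, top_le_iff, surrogate_of_ne_top a hf] at this
      exact EReal.coe_ne_top _ this
    refine ⟨hp, fun z hz => ?_⟩
    have := h z
    rw [surrogate_of_ne_top a hp, surrogate_of_ne_top a hz, EReal.coe_le_coe_iff] at this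
    linarith [key p a, key z a]
  · rintro ⟨hp, h⟩ z
    by_cases hz : Ψ z = ∞
    · rw [surrogate_of_eq_top a hz]; exact le_top
    · rw [surrogate_of_ne_top a hp, surrogate_of_ne_top a hz, EReal.coe_le_coe_iff]
      linarith [key p a, key z a, h z hz]

namespace IsProximal

variable {Ψ : E → ℝ≥0∞} {U : E → E}

theorem isSurrogateIteration_iff (hU : IsProximal Ψ U) (T : E →L[ℝ] H) (g : H) (u : ℕ → E) :
    IsSurrogateIteration T g Ψ u ↔ IsThresholdedLandweber T g U u := by
  refine forall_congr' fun m => ?_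
  rw [isMinOn_surrogate_iff ⟨U 0, (hU 0).1⟩, hU.isMinOn_iff]
  rfl

/-- At a fixed point the subgradient of `Ψ` is `2 T*(g - T p)`, the negative of the gradient of `‖T
· - g‖²`. -/
theorem isMinOn_of_fixed (hU : IsProximal Ψ U) {T : E →L[ℝ] H} {g : H} {p : E}
    (hp : U (landweberStep T g p) = p) : IsMinOn (costFunctional T g Ψ) univ p := by
  have h := hU (landweberStep T g p)
  rw [hp] at h
  refine (isMinOn_ofReal_add_iff ⟨p, h.1⟩ (fun z => sq_nonneg ‖T z - g‖)).2
    ⟨h.1, fun z hz => ?_⟩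
  have h1 := h.2 z hz
  rw [landweberStep, sub_add_cancel_left, inner_neg_right,
    ContinuousLinearMap.adjoint_inner_right, map_sub, ← inner_neg_right, neg_sub] at h1
  have h2 : ‖T z - g‖ ^ 2 = ‖T z - T p‖ ^ 2 + 2 * ⟪T z - T p, T p - g⟫_ℝ + ‖T p - g‖ ^ 2 := by
    rw [← norm_add_sq_real, sub_add_sub_cancel]
  nlinarith [sq_nonneg ‖T z - T p‖]

/-- Each step lowers the cost functional by a multiple of its squared length. -/
theorem cost_decrease (hU : IsProximal Ψ U) {T : E →L[ℝ] H} {g : H} {a b : E}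
    (hb : b = U (landweberStep T g a)) (ha : Ψ a ≠ ∞) :
    ‖T b - g‖ ^ 2 + (Ψ b).toReal + (1 - ‖T‖ ^ 2) * ‖b - a‖ ^ 2
      ≤ ‖T a - g‖ ^ 2 + (Ψ a).toReal := by
  have h1 := hU.add_norm_sq_le (landweberStep T g a) ha
  rw [← hb] at h1
  have h2 := norm_sq_landweberStep_sub T g b a
  have h3 := norm_sq_landweberStep_sub T g a a
  have h4 : ‖T b - T a‖ ^ 2 ≤ ‖T‖ ^ 2 * ‖b - a‖ ^ 2 := by
    rw [← mul_pow, ← map_sub]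
    exact pow_le_pow_left₀ (norm_nonneg _) (T.le_opNorm _) 2
  simp only [sub_self, norm_zero] at h3
  nlinarith [sq_nonneg ‖a - b‖]

end IsProximal

/-- With `d = x - y`, `‖d - T*T d‖² = ‖d‖² - 2‖T d‖² + ‖T*T d‖²`, and `‖T*T d‖ ≤ ‖T d‖`. -/
theorem norm_landweberStep_sub_le {T : E →L[ℝ] H} (hT : ‖T‖ < 1) (g : H) (x y : E) :
    ‖landweberStep T g x - landweberStep T g y‖ ≤ ‖x - y‖ := by
  have h1 : landweberStep T g x - landweberStep T g y
      = (x - y) - ContinuousLinearMap.adjoint T (T (x - y)) := by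
    simp only [landweberStep, map_sub]
    abel
  have h2 : ‖ContinuousLinearMap.adjoint T (T (x - y))‖ ≤ ‖T (x - y)‖ := by
    refine ((ContinuousLinearMap.adjoint T).le_opNorm _).trans ?_
    rw [LinearIsometryEquiv.norm_map]
    exact mul_le_of_le_one_left (norm_nonneg _) hT.le
  rw [h1]
  refine le_of_sq_le_sq ?_ (norm_nonneg _)
  rw [norm_sub_sq_real, ContinuousLinearMap.adjoint_inner_right, real_inner_self_eq_norm_sq]
  nlinarith [norm_nonneg (ContinuousLinearMap.adjoint T (T (x - y))), norm_nonneg (T (x - y))]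

theorem IsProximal.exists_weaklyConverges {Ψ : E → ℝ≥0∞} {U : E → E} (hU : IsProximal Ψ U)
    {T : E →L[ℝ] H} (hT : ‖T‖ < 1) {g : H}
    (hΨ : ∀ C : ℝ, ∃ R : ℝ, ∀ f, Ψ f ≠ ∞ → (Ψ f).toReal ≤ C → ‖f‖ ≤ R)
    {u : ℕ → E} (hu : IsThresholdedLandweber T g U u) :
    ∃ p, IsMinOn (costFunctional T g Ψ) univ p ∧ WeaklyConverges u p := by
  have hu' : ∀ m, u (m + 1) = U (landweberStep T g (u m)) := hu
  have hfin : ∀ m, Ψ (u (m + 1)) ≠ ∞ := fun m => by rw [hu']; exact (hU _).1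
  -- The index starts at `u 1` because `Ψ (u 0)` may be infinite; hence also the separate `‖u 0‖` in
  -- the bound below.
  let k : ℕ → ℝ := fun m => ‖T (u (m + 1)) - g‖ ^ 2 + (Ψ (u (m + 1))).toReal
  have hk : ∀ m, k (m + 1) + (1 - ‖T‖ ^ 2) * ‖u (m + 2) - u (m + 1)‖ ^ 2 ≤ k m :=
    fun m => hU.cost_decrease (hu' (m + 1)) (hfin m)
  have hT' : 0 < 1 - ‖T‖ ^ 2 := by nlinarith [norm_nonneg T]
  have hanti : Antitone k := antitone_nat_of_succ_le fun m => by
    nlinarith [hk m, mul_nonneg hT'.le (sq_nonneg ‖u (m + 2) - u (m + 1)‖)]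
  have hk0 : ∀ m, 0 ≤ k m := fun m => add_nonneg (by positivity) ENNReal.toReal_nonneg
  have hlim := tendsto_atTop_ciInf hanti ⟨0, by rintro _ ⟨m, rfl⟩; exact hk0 m⟩
  have hreg : Tendsto (fun m => ‖u (m + 1) - u m‖) atTop (𝓝 0) := by
    rw [← tendsto_add_atTop_iff_nat 1]
    have h1 : Tendsto (fun m => (k m - k (m + 1)) / (1 - ‖T‖ ^ 2)) atTop (𝓝 0) := by
      have := (hlim.sub (hlim.comp (tendsto_add_atTop_nat 1))).div_const (1 - ‖T‖ ^ 2)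
      simpa using this
    have h2 : Tendsto (fun m => ‖u (m + 1 + 1) - u (m + 1)‖ ^ 2) atTop (𝓝 0) :=
      squeeze_zero (fun m => by positivity)
        (fun m => by rw [le_div_iff₀ hT']; linarith [hk m]) h1
    simpa using h2.sqrt
  obtain ⟨R, hR⟩ := hΨ (k 0)
  have hb : ∀ m, ‖u m‖ ≤ max ‖u 0‖ R := by
    rintro (_ | m)
    · exact le_max_left _ _
    · refine (hR _ (hfin m) ?_).trans (le_max_right _ _)
      exact (le_add_of_nonneg_left (by positivity)).trans (hanti (Nat.zero_le m))
  obtain ⟨p, hp, hup⟩ := exists_weaklyConverges_of_nonexpansive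
    (fun x y => (hU.nonexpansive _ _).trans (norm_landweberStep_sub_le hT g x y)) hu' hb hreg
  exact ⟨p, hU.isMinOn_of_fixed hp, hup⟩

end Iteration

/-! ### Convex functionals: subgradients and existence of proximal points. -/

section ConvexFunctionals

variable {E : Type*}

section Module

variable [AddCommGroup E] [Module ℝ E]

/-- Convexity is taken over `ℝ≥0` because those scalars act on `ℝ≥0∞`; this returns to real
coefficients. -/
theorem ConvexOn.ennreal_toReal_segment_le {Ψ : E → ℝ≥0∞} (hΨ : ConvexOn ℝ≥0 univ Ψ) {x y : E}
    (hx : Ψ x ≠ ∞) (hy : Ψ y ≠ ∞) {t : ℝ} (h0 : 0 ≤ t) (h1 : t ≤ 1) :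
    Ψ ((1 - t) • x + t • y) ≠ ∞ ∧
      (Ψ ((1 - t) • x + t • y)).toReal ≤ (1 - t) * (Ψ x).toReal + t * (Ψ y).toReal := by
  lift t to ℝ≥0 using h0
  have h1' : t ≤ 1 := by exact_mod_cast h1
  have h := hΨ.2 (mem_univ x) (mem_univ y) zero_le zero_le (tsub_add_cancel_of_le h1')
  simp only [NNReal.smul_def, NNReal.coe_sub h1', NNReal.coe_one, ENNReal.smul_def,
    smul_eq_mul] at h
  have hfin : ((1 - t : ℝ≥0) : ℝ≥0∞) * Ψ x + (t : ℝ≥0∞) * Ψ y ≠ ∞ :=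
    ENNReal.add_ne_top.2 ⟨ENNReal.mul_ne_top ENNReal.coe_ne_top hx,
      ENNReal.mul_ne_top ENNReal.coe_ne_top hy⟩
  refine ⟨ne_top_of_le_ne_top hfin h, (ENNReal.toReal_mono hfin h).trans_eq ?_⟩
  rw [ENNReal.toReal_add (ENNReal.add_ne_top.1 hfin).1 (ENNReal.add_ne_top.1 hfin).2]
  rw [ENNReal.toReal_mul, ENNReal.toReal_mul, ENNReal.coe_toReal, ENNReal.coe_toReal,
    NNReal.coe_sub h1', NNReal.coe_one]

theorem ConvexOn.ennreal_ofReal {f : E → ℝ} (hf : ConvexOn ℝ univ f) (h0 : ∀ x, 0 ≤ f x) :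
    ConvexOn ℝ≥0 univ fun x => ENNReal.ofReal (f x) := by
  refine ⟨convex_univ, fun x _ y _ a b _ _ hab => ?_⟩
  have h := hf.2 (mem_univ x) (mem_univ y) a.coe_nonneg b.coe_nonneg (by exact_mod_cast hab)
  simp only [smul_eq_mul] at h
  simp only [NNReal.smul_def, ENNReal.smul_def, smul_eq_mul]
  refine (ENNReal.ofReal_le_ofReal h).trans_eq ?_
  rw [ENNReal.ofReal_add (mul_nonneg a.coe_nonneg (h0 x)) (mul_nonneg b.coe_nonneg (h0 y)),
    ENNReal.ofReal_mul a.coe_nonneg, ENNReal.ofReal_mul b.coe_nonneg, ENNReal.ofReal_coe_nnreal,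
    ENNReal.ofReal_coe_nnreal]

theorem ConvexOn.ennreal_tsum {ι : Type*} {f : ι → E → ℝ≥0∞}
    (hf : ∀ i, ConvexOn ℝ≥0 univ (f i)) : ConvexOn ℝ≥0 univ fun x => ∑' i, f i x := by
  refine ⟨convex_univ, fun x _ y _ a b ha hb hab => ?_⟩
  simp only [ENNReal.smul_def, smul_eq_mul]
  rw [← ENNReal.tsum_mul_left, ← ENNReal.tsum_mul_left, ← ENNReal.tsum_add]
  refine ENNReal.tsum_le_tsum fun i => ?_
  simpa only [ENNReal.smul_def, smul_eq_mul] using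
    (hf i).2 (mem_univ x) (mem_univ y) ha hb hab

end Module

variable [NormedAddCommGroup E] [InnerProductSpace ℝ E]

/-- The thresholding operators of a convex functional are proximal. -/
theorem IsThresholdingOperator.isProximal {Ψ : E → ℝ≥0∞} {U : E → E}
    (hU : IsThresholdingOperator Ψ U) (hfin : ∃ f, Ψ f ≠ ∞) (hΨ : ConvexOn ℝ≥0 univ Ψ) :
    IsProximal Ψ U := by
  intro x
  obtain ⟨hp, hmin⟩ := (isMinOn_ofReal_add_iff hfin (fun _ => by positivity)).1 (hU x)
  refine ⟨hp, fun z hz => ?_⟩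
  -- Compare `U x` with a point of the segment towards `z`, divide by `t`, then let `t` decrease to
  -- `0`.
  have key : ∀ t ∈ Ioc (0 : ℝ) 1,
      (Ψ (U x)).toReal ≤ (Ψ z).toReal + 2 * ⟪z - U x, U x - x⟫_ℝ + t * ‖z - U x‖ ^ 2 := by
    intro t ht
    obtain ⟨h1, h2⟩ := hΨ.ennreal_toReal_segment_le hp hz ht.1.le ht.2
    have h3 := hmin _ h1
    have h4 : ‖x - ((1 - t) • U x + t • z)‖ ^ 2
        = ‖x - U x‖ ^ 2 + 2 * (t * ⟪z - U x, U x - x⟫_ℝ) + t ^ 2 * ‖z - U x‖ ^ 2 := by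
      rw [norm_sub_rev, norm_sub_rev x (U x),
        show (1 - t) • U x + t • z - x = (U x - x) + t • (z - U x) by module,
        norm_add_sq_real, inner_smul_right, norm_smul, mul_pow, Real.norm_eq_abs, sq_abs,
        real_inner_comm]
    refine le_of_mul_le_mul_left ?_ ht.1
    nlinarith
  have hlim : Tendsto (fun t : ℝ => (Ψ z).toReal + 2 * ⟪z - U x, U x - x⟫_ℝ
      + t * ‖z - U x‖ ^ 2) (𝓝[>] 0) (𝓝 ((Ψ z).toReal + 2 * ⟪z - U x, U x - x⟫_ℝ)) := by
    have : Continuous fun t : ℝ => (Ψ z).toReal + 2 * ⟪z - U x, U x - x⟫_ℝ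
      + t * ‖z - U x‖ ^ 2 := by fun_prop
    simpa using (this.tendsto 0).mono_left nhdsWithin_le_nhds
  exact ge_of_tendsto hlim (eventually_of_mem (Ioc_mem_nhdsGT one_pos) key)

/-- Convex lower semicontinuous functionals on a Hilbert space have proximal points. -/
theorem exists_isMinOn_norm_sq_add [CompleteSpace E] {Ψ : E → ℝ≥0∞} (hfin : ∃ f, Ψ f ≠ ∞)
    (hΨ : ConvexOn ℝ≥0 univ Ψ) (hlsc : LowerSemicontinuous Ψ) (x : E) :
    ∃ p, IsMinOn (fun z => ENNReal.ofReal (‖x - z‖ ^ 2) + Ψ z) univ p := by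
  let F : E → ℝ := fun z => ‖x - z‖ ^ 2 + (Ψ z).toReal
  have hF : ∀ z, Ψ z ≠ ∞ → ENNReal.ofReal (‖x - z‖ ^ 2) + Ψ z = ENNReal.ofReal (F z) :=
    fun z hz => by
      rw [ENNReal.ofReal_add (by positivity) ENNReal.toReal_nonneg, ENNReal.ofReal_toReal hz]
  have hne : (F '' {z | Ψ z ≠ ∞}).Nonempty := let ⟨f, hf⟩ := hfin; ⟨F f, f, hf, rfl⟩
  have hbdd : BddBelow (F '' {z | Ψ z ≠ ∞}) :=
    ⟨0, by rintro _ ⟨z, -, rfl⟩; exact add_nonneg (by positivity) ENNReal.toReal_nonneg⟩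
  set I := sInf (F '' {z | Ψ z ≠ ∞}) with hI
  have hIle : ∀ z, Ψ z ≠ ∞ → I ≤ F z := fun z hz => csInf_le hbdd ⟨z, hz, rfl⟩
  have hex : ∀ n : ℕ, ∃ z, Ψ z ≠ ∞ ∧ F z < I + 1 / ((n : ℝ) + 1) := by
    intro n
    obtain ⟨_, ⟨z, hz, rfl⟩, h⟩ := exists_lt_of_csInf_lt hne
      (lt_add_of_pos_right I (Nat.one_div_pos_of_nat (α := ℝ) (n := n)))
    exact ⟨z, hz, h⟩
  choose z hz hzI using hex
  -- The midpoint has value at least `I`, so the parallelogram law forces minimizing sequences to be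
  -- Cauchy.
  have hpar : ∀ a b, Ψ a ≠ ∞ → Ψ b ≠ ∞ → ‖a - b‖ ^ 2 ≤ 2 * (F a + F b) - 4 * I := by
    intro a b ha hb
    obtain ⟨h1, h2⟩ := hΨ.ennreal_toReal_segment_le ha hb (t := 1 / 2) (by norm_num)
      (by norm_num)
    have h3 := hIle _ h1
    have h4 := parallelogram_law_with_norm ℝ (x - a) (x - b)
    have h5 : x - a + (x - b) = (2 : ℝ) • (x - ((1 - 1 / 2 : ℝ) • a + (1 / 2 : ℝ) • b)) := by
      module
    rw [h5, norm_smul, sub_sub_sub_cancel_left, norm_sub_rev b a] at h4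
    simp only [F] at h3 ⊢
    norm_num at h4 h2 h3 ⊢
    nlinarith
  have hcauchy : CauchySeq z := by
    refine cauchySeq_of_le_tendsto_0 (fun n : ℕ => √(4 * (1 / ((n : ℝ) + 1))))
      (fun n m k hn hm => ?_) ?_
    · rw [dist_eq_norm]
      refine Real.le_sqrt_of_sq_le ((hpar _ _ (hz n) (hz m)).trans ?_)
      have h1 : 1 / ((n : ℝ) + 1) ≤ 1 / ((k : ℝ) + 1) := Nat.one_div_le_one_div hn
      have h2 : 1 / ((m : ℝ) + 1) ≤ 1 / ((k : ℝ) + 1) := Nat.one_div_le_one_div hm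
      linarith [hzI n, hzI m]
    · simpa using (tendsto_one_div_add_atTop_nhds_zero_nat.const_mul (4 : ℝ)).sqrt
  obtain ⟨p, hp⟩ := cauchySeq_tendsto_of_complete hcauchy
  have hG : LowerSemicontinuous fun z => ENNReal.ofReal (‖x - z‖ ^ 2) + Ψ z :=
    (ENNReal.continuous_ofReal.comp (by fun_prop :
      Continuous fun z : E => ‖x - z‖ ^ 2)).lowerSemicontinuous.add hlsc
  have hpI : ENNReal.ofReal (‖x - p‖ ^ 2) + Ψ p ≤ ENNReal.ofReal I := by
    by_contra! hlt
    obtain ⟨c, hc1, hc2⟩ := exists_between hlt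
    have h1 : ∀ᶠ n in atTop, c < ENNReal.ofReal (‖x - z n‖ ^ 2) + Ψ (z n) :=
      hp.eventually (hG p c hc2)
    have h2 : Tendsto (fun n : ℕ => ENNReal.ofReal (I + 1 / ((n : ℝ) + 1))) atTop
        (𝓝 (ENNReal.ofReal I)) := by
      refine ENNReal.tendsto_ofReal ?_
      simpa using tendsto_one_div_add_atTop_nhds_zero_nat.const_add I
    obtain ⟨n, hn1, hn2⟩ := (h1.and (h2.eventually_lt_const hc1)).exists
    rw [hF _ (hz n)] at hn1
    exact (hn1.trans_le (ENNReal.ofReal_le_ofReal (hzI n).le)).not_gt hn2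
  refine ⟨p, isMinOn_univ_iff.2 fun w => hpI.trans ?_⟩
  by_cases hw : Ψ w = ∞
  · simp [hw]
  · rw [hF w hw]
    exact ENNReal.ofReal_le_ofReal (hIle w hw)

end ConvexFunctionals

/-! ### Norms on `ℝ^M`. -/

section NormFunction

variable {M : ℕ} {N : EuclideanSpace ℝ (Fin M) → ℝ}

theorem isNormFunction_lqNorm {q : ℝ≥0∞} (hq : 1 ≤ q) : IsNormFunction (M := M) (lqNorm q) := by
  have : Fact (1 ≤ q) := ⟨hq⟩
  refine ⟨fun x y => ?_, fun c x => ?_, fun x hx => ?_⟩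
  · exact norm_add_le (WithLp.toLp q (WithLp.ofLp x)) (WithLp.toLp q (WithLp.ofLp y))
  · exact norm_smul c (WithLp.toLp q (WithLp.ofLp x))
  · have h : WithLp.toLp q (WithLp.ofLp x) = 0 := norm_eq_zero.1 hx
    ext i
    exact congrArg (fun y : PiLp q (fun _ : Fin M => ℝ) => y i) h

namespace IsNormFunction

theorem nonneg (hN : IsNormFunction N) (x : EuclideanSpace ℝ (Fin M)) : 0 ≤ N x := by
  have h1 := hN.1 x ((-1 : ℝ) • x)
  have h2 := hN.2.1 0 0
  rw [hN.2.1, neg_one_smul, add_neg_cancel] at h1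
  simp at h1 h2
  linarith

theorem convexOn (hN : IsNormFunction N) : ConvexOn ℝ univ N := by
  refine ⟨convex_univ, fun x _ y _ a b ha hb _ => (hN.1 _ _).trans_eq ?_⟩
  rw [hN.2.1, hN.2.1, abs_of_nonneg ha, abs_of_nonneg hb, smul_eq_mul, smul_eq_mul]

theorem continuous (hN : IsNormFunction N) : Continuous N :=
  continuousOn_univ.1 (hN.convexOn.continuousOn isOpen_univ)

theorem exists_mul_norm_le (hN : IsNormFunction N) : ∃ k > 0, ∀ x, k * ‖x‖ ≤ N x := by
  -- The sphere is empty exactly when `M = 0`; otherwise `k` is the minimum of `N` on it.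
  rcases (Metric.sphere (0 : EuclideanSpace ℝ (Fin M)) 1).eq_empty_or_nonempty with h | h
  · refine ⟨1, one_pos, fun x => ?_⟩
    have hx : x = 0 := by
      by_contra hx
      have : (‖x‖⁻¹ • x) ∈ Metric.sphere (0 : EuclideanSpace ℝ (Fin M)) 1 := by
        simp [norm_smul, hx]
      simp [h] at this
    rw [hx, norm_zero, mul_zero]
    exact hN.nonneg 0
  · obtain ⟨e, he, hmin⟩ := (isCompact_sphere _ _).exists_isMinOn h hN.continuous.continuousOn
    have he1 : ‖e‖ = 1 := by simpa using he
    refine ⟨N e, (hN.nonneg e).lt_of_ne fun h0 => ?_, fun x => ?_⟩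
    · rw [hN.2.2 e h0.symm] at he1
      simp at he1
    · by_cases hx : x = 0
      · simp only [hx, norm_zero, mul_zero]
        exact hN.nonneg 0
      · have h1 : N e ≤ N (‖x‖⁻¹ • x) := hmin (by simp [norm_smul, hx])
        rw [hN.2.1, abs_of_nonneg (by positivity), inv_mul_eq_div,
          le_div_iff₀ (norm_pos_iff.2 hx)] at h1
        exact h1

end IsNormFunction

end NormFunction

/-! ### Convexity, lower semicontinuity and coercivity of the joint sparsity measure. -/

section JointSparsity

variable {Λ : Type*} {M : ℕ} {N : EuclideanSpace ℝ (Fin M) → ℝ} {v ω : Λ → ℝ}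

theorem VecSeq.continuous_apply (l : Λ) : Continuous fun u : VecSeq Λ M => u l :=
  (lp.lipschitzWith_one_eval 2 l).continuous

theorem VecSeq.enorm_sq_eq_tsum (u : VecSeq Λ M) : ‖u‖ₑ ^ 2 = ∑' l, ‖u l‖ₑ ^ 2 := by
  have h := lp.hasSum_norm (p := 2) (by simp) u
  simp only [ENNReal.toReal_ofNat, Real.rpow_ofNat] at h
  simp only [← ofReal_norm, ← ENNReal.ofReal_pow (norm_nonneg _)]
  rw [← h.tsum_eq, ENNReal.ofReal_tsum_of_nonneg (fun _ => by positivity) h.summable]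

/-- Each factor of `‖u l‖ₑ * ‖u l‖ₑ` is at most the whole sum. Used for coercivity when only `v` is
bounded below. -/
theorem VecSeq.enorm_le_tsum (u : VecSeq Λ M) : ‖u‖ₑ ≤ ∑' l, ‖u l‖ₑ := by
  rw [← ENNReal.pow_le_pow_left_iff two_ne_zero, VecSeq.enorm_sq_eq_tsum, sq (∑' l, ‖u l‖ₑ),
    ← ENNReal.tsum_mul_left]
  refine ENNReal.tsum_le_tsum fun l => ?_
  rw [sq]
  gcongr
  exact ENNReal.le_tsum l

theorem jointSparsity_zero (hN : IsNormFunction N) :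
    jointSparsity N v ω (0 : VecSeq Λ M) = 0 := by
  have h := hN.2.1 0 0
  simp only [zero_smul, abs_zero, zero_mul] at h
  simp [jointSparsity, h]

theorem lowerSemicontinuous_jointSparsity (hN : IsNormFunction N) :
    LowerSemicontinuous (jointSparsity N v ω : VecSeq Λ M → ℝ≥0∞) := by
  refine (lowerSemicontinuous_tsum fun l => Continuous.lowerSemicontinuous ?_).add
    (lowerSemicontinuous_tsum fun l => Continuous.lowerSemicontinuous ?_)
  · exact ENNReal.continuous_ofReal.comp
      ((hN.continuous.comp (VecSeq.continuous_apply l)).const_mul _)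
  · exact ENNReal.continuous_ofReal.comp
      (((VecSeq.continuous_apply l).norm.pow 2).const_mul _)

theorem convexOn_jointSparsity (hN : IsNormFunction N) (hv : ∀ l, 0 ≤ v l)
    (hω : ∀ l, 0 ≤ ω l) : ConvexOn ℝ≥0 univ (jointSparsity N v ω : VecSeq Λ M → ℝ≥0∞) := by
  have hev : ∀ (f : EuclideanSpace ℝ (Fin M) → ℝ) (l : Λ), ConvexOn ℝ univ f →
      ConvexOn ℝ univ fun u : VecSeq Λ M => f (u l) := fun f l hf =>
    ⟨convex_univ, fun x _ y _ a b ha hb hab => hf.2 (mem_univ (x l)) (mem_univ (y l)) ha hb hab⟩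
  refine (ConvexOn.ennreal_tsum fun l => ?_).add (ConvexOn.ennreal_tsum fun l => ?_)
  · exact ((hev N l hN.convexOn).smul (hv l)).ennreal_ofReal
      fun u => mul_nonneg (hv l) (hN.nonneg _)
  · exact ((hev _ l (convexOn_univ_norm.pow (fun _ _ => norm_nonneg _) 2)).smul
      (hω l)).ennreal_ofReal fun u => mul_nonneg (hω l) (sq_nonneg _)

theorem jointSparsity_coercive (hN : IsNormFunction N) (hv : ∀ l, 0 ≤ v l)
    (hvω : (∃ c > 0, ∀ l, c ≤ v l) ∨ ∃ c > 0, ∀ l, c ≤ ω l) (C : ℝ) :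
    ∃ R : ℝ, ∀ f : VecSeq Λ M, jointSparsity N v ω f ≠ ∞ →
      (jointSparsity N v ω f).toReal ≤ C → ‖f‖ ≤ R := by
  rcases hvω with ⟨c, hc, hcv⟩ | ⟨c, hc, hcω⟩
  · obtain ⟨k, hk, hkN⟩ := hN.exists_mul_norm_le
    refine ⟨C / (c * k), fun f hf hC => ?_⟩
    have h1 : ENNReal.ofReal (c * k) * ‖f‖ₑ ≤ jointSparsity N v ω f := by
      refine le_trans ?_ le_self_add
      refine (mul_le_mul_right (VecSeq.enorm_le_tsum f) _).trans ?_
      rw [← ENNReal.tsum_mul_left]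
      refine ENNReal.tsum_le_tsum fun l => ?_
      rw [← ofReal_norm, ← ENNReal.ofReal_mul (by positivity), mul_assoc]
      exact ENNReal.ofReal_le_ofReal
        (mul_le_mul (hcv l) (hkN _) (by positivity) (hv l))
    have h2 := (ENNReal.toReal_mono hf h1).trans hC
    rw [ENNReal.toReal_mul, ENNReal.toReal_ofReal (by positivity), toReal_enorm] at h2
    rwa [le_div_iff₀' (by positivity)]
  · refine ⟨√(C / c), fun f hf hC => Real.le_sqrt_of_sq_le ?_⟩
    have h1 : ENNReal.ofReal c * ‖f‖ₑ ^ 2 ≤ jointSparsity N v ω f := by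
      refine le_trans ?_ le_add_self
      rw [VecSeq.enorm_sq_eq_tsum, ← ENNReal.tsum_mul_left]
      refine ENNReal.tsum_le_tsum fun l => ?_
      rw [← ofReal_norm, ← ENNReal.ofReal_pow (norm_nonneg _),
        ← ENNReal.ofReal_mul hc.le]
      exact ENNReal.ofReal_le_ofReal (mul_le_mul_of_nonneg_right (hcω l) (by positivity))
    have h2 := (ENNReal.toReal_mono hf h1).trans hC
    rw [ENNReal.toReal_mul, ENNReal.toReal_ofReal hc.le, ENNReal.toReal_pow, toReal_enorm] at h2
    rwa [le_div_iff₀' hc]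

end JointSparsity

/-! ### Consequences of condition 3 and of strict convexity. -/

section VariationalInequality

variable {E H : Type*} [NormedAddCommGroup E] [InnerProductSpace ℝ E]
  [NormedAddCommGroup H] [InnerProductSpace ℝ H]

/-- Condition 3 with `h = z - U x` is the subgradient inequality; minimality supplies the finiteness
of `Ψ (U x)`. -/
theorem IsThresholdingOperator.isProximal_of_ereal {Ψ : E → ℝ≥0∞} {U : E → E}
    (hU : IsThresholdingOperator Ψ U) (hfin : ∃ f, Ψ f ≠ ∞)
    (h : ∀ x h, (0 : EReal) ≤ (Ψ (U x + h) : EReal) - (Ψ (U x) : EReal)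
      + ((2 * ⟪h, U x - x⟫_ℝ : ℝ) : EReal)) : IsProximal Ψ U := by
  intro x
  have hp := ((isMinOn_ofReal_add_iff hfin (fun _ => by positivity)).1 (hU x)).1
  refine ⟨hp, fun z hz => ?_⟩
  have h1 := h x (z - U x)
  rw [add_sub_cancel, ← ENNReal.ofReal_toReal hp, ← ENNReal.ofReal_toReal hz,
    EReal.coe_ennreal_ofReal, EReal.coe_ennreal_ofReal, max_eq_left ENNReal.toReal_nonneg,
    max_eq_left ENNReal.toReal_nonneg] at h1
  have h2 : (0 : ℝ) ≤ (Ψ z).toReal - (Ψ (U x)).toReal + 2 * ⟪z - U x, U x - x⟫_ℝ := by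
    exact_mod_cast h1
  linarith

theorem StrictlyConvex.eq_of_isMinOn {F : E → ℝ≥0∞} (hF : StrictlyConvex F)
    (hfin : ∃ f, F f ≠ ∞) {p q : E} (hp : IsMinOn F univ p) (hq : IsMinOn F univ q) : p = q := by
  obtain ⟨f, hf⟩ := hfin
  have key : ∀ {r}, IsMinOn F univ r →
      F r ≠ ∞ ∧ IsMinOn (fun u => (F u).toReal) {u | F u ≠ ∞} r := fun hr =>
    ⟨ne_top_of_le_ne_top hf (isMinOn_univ_iff.1 hr f),
      isMinOn_iff.2 fun z hz => ENNReal.toReal_mono hz (isMinOn_univ_iff.1 hr z)⟩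
  exact StrictConvexOn.eq_of_isMinOn hF (key hp).2 (key hq).2 (key hp).1 (key hq).1

end VariationalInequality

/-! ### The two parts assembled. -/

theorem mainTheorem6 {Λ : Type*} [Countable Λ] {M : ℕ} {H : Type*} [NormedAddCommGroup H]
    [InnerProductSpace ℝ H] [CompleteSpace H]
    (T : VecSeq Λ M →L[ℝ] H) (hT : ‖T‖ < 1) (g : H) :
    -- general sparsity measures
    (∀ (Ψ : VecSeq Λ M → ℝ≥0∞) (U : VecSeq Λ M → VecSeq Λ M),
      (∃ f, Ψ f ≠ ∞) →
      StrictlyConvex (costFunctional T g Ψ) →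
      IsThresholdingOperator Ψ U →
      (∀ x y, ‖U x - U y‖ ≤ ‖x - y‖) →
      (∃ h : ℝ≥0 → ℝ, Monotone h ∧ ∀ f, Ψ f ≠ ∞ → ‖f‖ ≤ h (Ψ f).toNNReal) →
      (∀ x h, (0 : EReal) ≤ (Ψ (U x + h) : EReal) - (Ψ (U x) : EReal)
        + ((2 * ⟪h, U x - x⟫_ℝ : ℝ) : EReal)) →
      ∃ ustar : VecSeq Λ M,
        (∀ w, IsMinOn (costFunctional T g Ψ) univ w ↔ w = ustar) ∧
        ∀ u : ℕ → VecSeq Λ M,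
          (IsSurrogateIteration T g Ψ u ↔ IsThresholdedLandweber T g U u) ∧
          (IsThresholdedLandweber T g U u → WeaklyConverges u ustar)) ∧
    -- the weighted joint sparsity measures, for an `ℓ_q` norm or any other norm on `ℝ^M`
    (∀ (N : EuclideanSpace ℝ (Fin M) → ℝ) (v ω : Λ → ℝ),
      ((∃ q : ℝ≥0∞, 1 ≤ q ∧ N = lqNorm q) ∨ IsNormFunction N) →
      (∀ l, 0 ≤ v l) → (∀ l, 0 ≤ ω l) →
      ((∃ c > 0, ∀ l, c ≤ v l) ∨ (∃ c > 0, ∀ l, c ≤ ω l)) →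
      (∃! U : VecSeq Λ M → VecSeq Λ M, IsThresholdingOperator (jointSparsity N v ω) U) ∧
      ∀ U : VecSeq Λ M → VecSeq Λ M, IsThresholdingOperator (jointSparsity N v ω) U →
        ∀ u : ℕ → VecSeq Λ M,
          (IsSurrogateIteration T g (jointSparsity N v ω) u ↔ IsThresholdedLandweber T g U u) ∧
          (IsThresholdedLandweber T g U u →
            ∃ ustar, IsMinOn (costFunctional T g (jointSparsity N v ω)) univ ustar ∧
              WeaklyConverges u ustar)) := by
  refine ⟨fun Ψ U hfin hK hU _ ⟨h, hh, hΨ⟩ hvar => ?_, fun N v ω hN hv hω hvω => ?_⟩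
  · have hP := hU.isProximal_of_ereal hfin hvar
    have hco : ∀ C : ℝ, ∃ R : ℝ, ∀ f, Ψ f ≠ ∞ → (Ψ f).toReal ≤ C → ‖f‖ ≤ R := fun C =>
      ⟨h C.toNNReal, fun f hf hC => (hΨ f hf).trans (hh (NNReal.le_toNNReal_of_coe_le hC))⟩
    have hconv := fun {u} hu => hP.exists_weaklyConverges hT (g := g) hco (u := u) hu
    -- Existence of a minimizer comes from the algorithm itself: the orbit of `0` has one as its
    -- weak limit.
    obtain ⟨p, hp, -⟩ := hconv
      (u := fun m => (fun a => U (landweberStep T g a))^[m] 0)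
      fun m => Function.iterate_succ_apply' _ _ _
    have hfin' : ∃ f, costFunctional T g Ψ f ≠ ∞ :=
      hfin.imp fun f hf => ENNReal.add_ne_top.2 ⟨ENNReal.ofReal_ne_top, hf⟩
    refine ⟨p, fun w => ⟨fun hw => hK.eq_of_isMinOn hfin' hw hp, ?_⟩, fun u =>
      ⟨hP.isSurrogateIteration_iff T g u, fun hu => ?_⟩⟩
    · rintro rfl
      exact hp
    · obtain ⟨q, hq, huq⟩ := hconv hu
      rwa [hK.eq_of_isMinOn hfin' hp hq]
  · have hN' : IsNormFunction N := by
      rcases hN with ⟨q, hq, rfl⟩ | hN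
      · exact isNormFunction_lqNorm hq
      · exact hN
    have hfin : ∃ f : VecSeq Λ M, jointSparsity N v ω f ≠ ∞ :=
      ⟨0, by rw [jointSparsity_zero hN']; exact ENNReal.zero_ne_top⟩
    have hcvx := convexOn_jointSparsity (M := M) hN' hv hω
    have hP : ∀ {U : VecSeq Λ M → VecSeq Λ M}, IsThresholdingOperator (jointSparsity N v ω) U →
      IsProximal (jointSparsity N v ω) U := fun hU => hU.isProximal hfin hcvx
    refine ⟨?_, fun U hU u => ⟨(hP hU).isSurrogateIteration_iff T g u, fun hu =>
      (hP hU).exists_weaklyConverges hT (jointSparsity_coercive hN' hv hvω) hu⟩⟩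
    choose U hU using exists_isMinOn_norm_sq_add hfin hcvx
      (lowerSemicontinuous_jointSparsity hN')
    exact ⟨U, hU, fun V hV => funext fun x => (hP hU).isMinOn_iff.1 (hV x)⟩
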